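/- Let $d\ge 1$, let $f\in\mathbb{R}[x_1,\dots,x_n]$ be homogeneous of degree $d$, irreducible over $\mathbb{R}$, and hyperbolic with respect to $e\in\mathbb{R}^n$, i.e. $f(e)\neq 0$ and for every $a\in\mathbb{R}^n$ all complex roots of $f(te+a)\in\mathbb{R}[t]$ are real. Let $A=(a_{ij})$ be a symmetric $d\times d$ matrix whose entries are real forms of degree $d-1$ (the zero form being allowed), and suppose that $A$ has rank at most one modulo $(f)$, i.e. $f$ divides every $2\times2$ minor of $A$. Write $A^{\rm adj}$ for the adjugate matrix of $A$. Then $f^{d-2}$ divides every entry of $A^{\rm adj}$, the matrix $$M=\frac{1}{f^{d-2}}A^{\rm adj}$$ has entries that are linear forms or zero, and there is $\gamma\in\mathbb{R}$ with $\det M=\gamma f$. (For $d=1$ the divisibility claim is empty and $M$ is the $1\times1$ matrix $(f)$.) If moreover $a_{11}$ interlaces $f$ with respect to $e$ and $A$ has full rank, in the sense that the columns of $A$ are linearly independent over $\mathbb{R}$ (there is no nonzero $v\in\mathbb{R}^d$ with $Av=0$; this holds in particular if $\det A$ is not the zero polynomial), then $\gamma\neq0$ and the real symmetric matrix $M(e)$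 is definite (positive definite or negative definite). Here a form $g$ of degree $d-1$ interlaces $f$ with respect to $e$ if for every $a\in\mathbb{R}^n$ the polynomials $f(te+a)$ and $g(te+a)$ in $t$ have only real roots and degrees $d$ and $d-1$, and their roots, listed with multiplicity as $\alpha_1\le\dots\le\alpha_d$ and $\beta_1\le\dots\le\beta_{d-1}$ respectively, satisfy $\alpha_i\le\beta_i\le\alpha_{i+1}$ for $i=1,\dots,d-1$. -/

import Mathlib

open MvPolynomial

noncomputable section

/-- A univariate real polynomial is real-rooted if it is nonzero and all its complex roots are
real. (The zero polynomial is excluded, since every complex number is a root of it.) -/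
def RealRooted (p : Polynomial ℝ) : Prop :=
  ∀ z : ℂ, Polynomial.aeval z p = 0 → z.im = 0

/-- `g` interlaces `f`, for univariate real polynomials: both have only real zeros, with
`deg g = deg f - 1`, and the roots `α₀ ≤ ⋯ ≤ αₘ` of `f` and `β₀ ≤ ⋯ ≤ βₘ₋₁` of `g`, listed with
multiplicity in increasing order, satisfy `αᵢ ≤ βᵢ ≤ αᵢ₊₁`. -/
def UnivInterlaces (g f : Polynomial ℝ) : Prop :=
  RealRooted f ∧ RealRooted g ∧
    ∃ m : ℕ, f.natDegree = m + 1 ∧ g.natDegree = m ∧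
      ∃ (α : Fin (m + 1) → ℝ) (β : Fin m → ℝ), Monotone α ∧ Monotone β ∧
        f.roots = Finset.univ.val.map α ∧ g.roots = Finset.univ.val.map β ∧
        ∀ i : Fin m, α i.castSucc ≤ β i ∧ β i ≤ α i.succ

/-- The univariate polynomial `f(t e + a)` in the variable `t`. -/
def lineRestrict {n : ℕ} (f : MvPolynomial (Fin n) ℝ) (e a : Fin n → ℝ) : Polynomial ℝ :=
  MvPolynomial.aeval
    (fun i => Polynomial.C (e i) * Polynomial.X + Polynomial.C (a i)) f

/-- `f` is homogeneous and hyperbolic with respect to `e`: `f(e) ≠ 0` and for every `a` all roots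
of `f(t e + a)` are real. -/
def HyperbolicWrt {n : ℕ} (f : MvPolynomial (Fin n) ℝ) (e : Fin n → ℝ) : Prop :=
  (∃ d : ℕ, f.IsHomogeneous d) ∧ MvPolynomial.eval e f ≠ 0 ∧
    ∀ a : Fin n → ℝ, RealRooted (lineRestrict f e a)

/-- `g` interlaces the hyperbolic polynomial `f` with respect to `e`: `g` is homogeneous of degree
`deg f - 1` and `g(t e + a)` interlaces `f(t e + a)` for every `a`. -/
def InterlacesWrt {n : ℕ} (g f : MvPolynomial (Fin n) ℝ) (e : Fin n → ℝ) : Prop :=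
  HyperbolicWrt f e ∧ (∃ m : ℕ, f.IsHomogeneous (m + 1) ∧ g.IsHomogeneous m) ∧
    ∀ a : Fin n → ℝ, UnivInterlaces (lineRestrict g e a) (lineRestrict f e a)

/-- The matrix `A` has rank (at most) one modulo `(f)`: all `2 × 2` minors of `A` lie in the
ideal `(f)`. -/
def RankLEOneMod {n d : ℕ} (A : Matrix (Fin d) (Fin d) (MvPolynomial (Fin n) ℝ))
    (f : MvPolynomial (Fin n) ℝ) : Prop :=
  ∀ i j k l : Fin d, f ∣ A i k * A j l - A i l * A j k

/-- The matrix of polynomials `A` has full rank, in the sense that its columns are linearly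
independent over `ℝ`: no nonzero constant vector `v` satisfies `A v = 0`. This holds in particular
if `det A` is not the zero polynomial. -/
def FullRank {n d : ℕ} (A : Matrix (Fin d) (Fin d) (MvPolynomial (Fin n) ℝ)) : Prop :=
  ∀ v : Fin d → ℝ, A.mulVec (fun i => MvPolynomial.C (v i)) = 0 → v = 0

/-- A real symmetric matrix is definite if it is positive definite or negative definite. -/
def IsDefiniteMatrix {d : ℕ} (B : Matrix (Fin d) (Fin d) ℝ) : Prop :=
  B.PosDef ∨ (-B).PosDef

end

/-! Divisibility: a `k × k` matrix of rank at most one modulo a prime `p` has determinant divisible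
by `p ^ (k - 1)` (`pow_dvd_det_of_dvd_minors`). Applied to the maximal minors of `A`, and to `A`
itself, this yields `M`; comparing degrees makes `M` linear and `det M` a scalar multiple of `f`.

Definiteness: for constant `v` put `g = vᵀ A v`. Modulo `f`, `a₁₁ g` is the square of the first
entry of `A v`, so `g` and `a₁₁` have the same weak sign on the real zeros of `f`. On a generic line
in direction `e` the interlacing is strict, and Lagrange interpolation at the zeros of `f` writes
`g(e) a₁₁(e)` as a sum of nonnegative terms. If it vanishes then `g = 0`, so `f` divides the squares
of the entries of `A v`, which have degree below `deg f`; hence `A v = 0` and `v = 0` by full rank.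
So `A(e)` is definite, and `M(e)` is a nonzero multiple of its inverse. -/

/-! ### Determinants of matrices of rank one modulo a prime. -/

theorem pow_dvd_of_pow_dvd_pow_of_lt {R : Type*} [CommRing R] [IsDomain R]
    [UniqueFactorizationMonoid R] {p x : R} (hp : Prime p) {a b n : ℕ} (h : p ^ a ∣ x ^ n) (hab : (b - 1) * n < a) :
    p ^ b ∣ x := by
  rcases eq_or_ne x 0 with rfl | hx
  · simp
  have hfin : FiniteMultiplicity p x := .of_prime_left hp hx
  have hfin' : FiniteMultiplicity p (x ^ n) := .of_prime_left hp (pow_ne_zero _ hx)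
  have h1 := hfin'.le_multiplicity_of_pow_dvd h
  rw [hfin.multiplicity_pow hp] at h1
  apply pow_dvd_of_le_multiplicity
  by_contra! hlt
  have h2 : multiplicity p x ≤ b - 1 := by omega
  have h3 := Nat.mul_le_mul_right n h2
  rw [mul_comm n] at h1
  omega

/-- Induction on the size through `det (adj B) = (det B) ^ (size - 1)`: the cofactors are divisible
by induction, and primality of `p` allows the root to be extracted. -/
theorem pow_dvd_det_of_dvd_minors {R : Type*} [CommRing R] [IsDomain R]
    [UniqueFactorizationMonoid R] {p : R} (hp : Prime p) (k : ℕ)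
    (B : Matrix (Fin k) (Fin k) R)
    (h : ∀ i j k l, p ∣ B i k * B j l - B i l * B j k) : p ^ (k - 1) ∣ B.det := by
  induction k with
  | zero => simp
  | succ k ih =>
    obtain rfl | rfl | hk : k = 0 ∨ k = 1 ∨ 2 ≤ k := by omega
    · simp
    · simpa [Matrix.det_fin_two] using h 0 1 0 1
    have hadj : ∀ i j, p ^ (k - 1) ∣ B.adjugate i j := fun i j => by
      rw [Matrix.adjugate_fin_succ_eq_det_submatrix]
      exact (ih (B.submatrix j.succAbove i.succAbove) fun _ _ _ _ => h _ _ _ _).mul_left _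
    choose N hN using hadj
    have hB : B.adjugate = p ^ (k - 1) • Matrix.of N := by
      ext i j
      simp [hN]
    have hdet : p ^ ((k - 1) * (k + 1)) ∣ B.det ^ k := by
      have := Matrix.det_adjugate B
      rw [hB, Matrix.det_smul, Fintype.card_fin, ← pow_mul] at this
      exact ⟨_, by simpa using this.symm⟩
    -- The exponent is large enough because `(k - 1) * k < (k - 1) * (k + 1)`, which needs `k ≥ 2`;
    -- size two is therefore a separate base case.
    refine pow_dvd_of_pow_dvd_pow_of_lt hp hdet ?_
    obtain ⟨m, rfl⟩ := Nat.exists_eq_add_of_le hk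
    simp only [Nat.add_sub_cancel]
    rw [show 2 + m - 1 = m + 1 by omega]
    nlinarith

/-! ### Degree counts and the divided adjugate. -/

theorem isHomogeneous_of_mul_left {σ R : Type*} [CommRing R] [IsDomain R]
    {f g : MvPolynomial σ R} {a b : ℕ} (hf : f.IsHomogeneous a) (hf0 : f ≠ 0)
    (hfg : (f * g).IsHomogeneous (a + b)) : g.IsHomogeneous b := by
  have key : ∀ m, m ≠ b → homogeneousComponent m g = 0 := by
    intro m hm
    have hsum : f * g = ∑ i ∈ Finset.range (g.totalDegree + 1), f * homogeneousComponent i g := by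
      rw [← Finset.mul_sum, sum_homogeneousComponent]
    by_cases hmd : g.totalDegree < m
    · exact homogeneousComponent_eq_zero m g hmd
    have h1 : homogeneousComponent (a + m) (f * g) = f * homogeneousComponent m g := by
      rw [hsum, map_sum, Finset.sum_eq_single m]
      · exact homogeneousComponent_eq_self (hf.mul (homogeneousComponent_isHomogeneous m g))
      · intro i _ hi
        rw [homogeneousComponent_of_mem (hf.mul (homogeneousComponent_isHomogeneous i g)),
          if_neg (by omega)]
      · intro h
        simp at h
        omega
    rw [homogeneousComponent_of_mem hfg, if_neg (by omega)] at h1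
    exact (mul_eq_zero.1 h1.symm).resolve_left hf0
  have : g = homogeneousComponent b g := by
    conv_lhs => rw [← sum_homogeneousComponent g]
    by_cases hb : b ≤ g.totalDegree
    · rw [Finset.sum_eq_single b (fun i _ hi => key i hi)]
      intro h
      simp at h
      omega
    · rw [homogeneousComponent_eq_zero b g (by omega)]
      refine Finset.sum_eq_zero fun i hi => key i ?_
      simp at hi
      omega
  rw [this]
  exact homogeneousComponent_isHomogeneous b g

theorem isHomogeneous_det {σ R ι : Type*} [CommRing R] [Fintype ι] [DecidableEq ι]
    {B : Matrix ι ι (MvPolynomial σ R)} {m : ℕ} (hB : ∀ i j, (B i j).IsHomogeneous m) :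
    B.det.IsHomogeneous (Fintype.card ι * m) := by
  rw [Matrix.det_apply]
  refine IsHomogeneous.sum _ _ _ fun s _ => ?_
  have h : (∏ i, B (s i) i).IsHomogeneous (Fintype.card ι * m) := by
    simpa using IsHomogeneous.prod Finset.univ (fun i => B (s i) i) (fun _ => m)
      fun i _ => hB _ _
  rcases Int.units_eq_one_or (Equiv.Perm.sign s) with hs | hs <;> rw [hs]
  · simpa using h
  · simpa using h.neg

theorem isHomogeneous_adjugate {σ R : Type*} [CommRing R] {d m : ℕ}
    {B : Matrix (Fin (d + 1)) (Fin (d + 1)) (MvPolynomial σ R)}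
    (hB : ∀ i j, (B i j).IsHomogeneous m) (i j : Fin (d + 1)) :
    (B.adjugate i j).IsHomogeneous (d * m) := by
  rw [Matrix.adjugate_fin_succ_eq_det_submatrix]
  have h : (B.submatrix j.succAbove i.succAbove).det.IsHomogeneous (d * m) := by
    simpa using isHomogeneous_det (B := B.submatrix j.succAbove i.succAbove) fun _ _ => hB _ _
  rcases neg_one_pow_eq_or (MvPolynomial σ R) (j + i : ℕ) with hs | hs <;> rw [hs]
  · simpa using h
  · simpa using h.neg

theorem eq_zero_of_dvd_of_isHomogeneous {σ R : Type*} [CommRing R] [IsDomain R]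
    {f g : MvPolynomial σ R} {a b : ℕ} (hf : f.IsHomogeneous a) (hf0 : f ≠ 0)
    (hg : g.IsHomogeneous b) (hba : b < a) (h : f ∣ g) : g = 0 := by
  obtain ⟨q, rfl⟩ := h
  by_contra hne
  have hq : q ≠ 0 := right_ne_zero_of_mul hne
  have := hg.totalDegree hne
  rw [totalDegree_mul_of_isDomain hf0 hq, hf.totalDegree hf0] at this
  omega

/-- If `A` has rank one modulo `f`, its adjugate is divisible by the power `f ^ (d - 1)`, and the
quotient is a linear matrix whose determinant is a multiple of `f`. -/
theorem exists_divided_adjugate {σ : Type*} {d : ℕ} {f : MvPolynomial σ ℝ}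
    (hfd : f.IsHomogeneous (d + 1)) (hf : Prime f)
    {A : Matrix (Fin (d + 1)) (Fin (d + 1)) (MvPolynomial σ ℝ)}
    (hdeg : ∀ i j, (A i j).IsHomogeneous d)
    (hrank : ∀ i j k l, f ∣ A i k * A j l - A i l * A j k) :
    (∀ i j, f ^ (d - 1) ∣ A.adjugate i j) ∧
    ∃ M : Matrix (Fin (d + 1)) (Fin (d + 1)) (MvPolynomial σ ℝ),
      f ^ d • M = f • A.adjugate ∧ (∀ i j, (M i j).IsHomogeneous 1) ∧
      ∃ γ : ℝ, M.det = C γ * f := by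
  have hf0 := hf.ne_zero
  have hadj : ∀ i j, f ^ (d - 1) ∣ A.adjugate i j := fun i j => by
    rw [Matrix.adjugate_fin_succ_eq_det_submatrix]
    exact (pow_dvd_det_of_dvd_minors hf d (A.submatrix j.succAbove i.succAbove)
      fun _ _ _ _ => hrank _ _ _ _).mul_left _
  refine ⟨hadj, ?_⟩
  -- The extra factor `f` on both sides avoids a negative exponent: for `d = 0` (size one) the
  -- quotient is the matrix `(f)`.
  have hM : ∀ i j, f ^ d ∣ f * A.adjugate i j := fun i j => by
    refine (pow_dvd_pow f (show d ≤ d - 1 + 1 by omega)).trans ?_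
    rw [pow_succ']
    exact mul_dvd_mul_left f (hadj i j)
  choose M hM using hM
  have hMA : f ^ d • Matrix.of M = f • A.adjugate := by
    ext1 i j
    simp [hM]
  refine ⟨Matrix.of M, hMA, fun i j => ?_, ?_⟩
  · refine isHomogeneous_of_mul_left (hfd.pow d) (pow_ne_zero _ hf0) ?_
    rw [Matrix.of_apply, ← hM]
    have h := hfd.mul (isHomogeneous_adjugate hdeg i j)
    rwa [show d + 1 + d * d = (d + 1) * d + 1 by ring] at h
  · obtain ⟨h, hh⟩ := pow_dvd_det_of_dvd_minors hf (d + 1) A hrank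
    rw [Nat.add_sub_cancel] at hh
    have hh0 : h.IsHomogeneous 0 := by
      refine isHomogeneous_of_mul_left (hfd.pow d) (pow_ne_zero _ hf0) ?_
      rw [← hh]
      convert isHomogeneous_det hdeg using 1
      simp [mul_comm]
    obtain ⟨c, rfl⟩ : ∃ c, h = C c :=
      ⟨_, totalDegree_eq_zero_iff_eq_C.1 (Nat.le_zero.1 hh0.totalDegree_le)⟩
    -- With `det A = c f ^ d`, determinants give `f ^ (d (d + 1)) det M = f ^ (d + 1) (c f ^ d) ^
    -- d`.
    refine ⟨c ^ d, ?_⟩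
    have := congrArg Matrix.det hMA
    rw [Matrix.det_smul, Matrix.det_smul, Matrix.det_adjugate, hh, Fintype.card_fin,
      Nat.add_sub_cancel] at this
    refine mul_left_cancel₀ (pow_ne_zero (d * (d + 1)) hf0) ?_
    rw [pow_mul, this, C_pow]
    ring
-- Univariate interlacing and Lagrange interpolation.
open Polynomial in
/-- At strictly interlacing nodes the Lagrange weights carry the signs of the interlacer. -/
theorem prod_sub_mul_prod_sub_pos {m : ℕ} {α : Fin (m + 1) → ℝ} {β : Fin m → ℝ}
    (h : ∀ i : Fin m, α i.castSucc < β i ∧ β i < α i.succ) (i : Fin (m + 1)) :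
    0 < (∏ j : Fin m, (α i - α (i.succAbove j))) * ∏ j : Fin m, (α i - β j) := by
  have hα : Monotone α := Fin.monotone_iff_le_succ.2 fun i => ((h i).1.trans (h i).2).le
  -- The `j`-th factors of the two products are paired: both are positive for `j < i` and both
  -- negative otherwise.
  rw [← Finset.prod_mul_distrib]
  refine Finset.prod_pos fun j _ => ?_
  rcases lt_or_ge j.castSucc i with hj | hj
  · rw [Fin.succAbove_of_castSucc_lt _ _ hj]
    have h1 : α j.succ ≤ α i := hα (Fin.castSucc_lt_iff_succ_le.1 hj)
    have := h j
    exact mul_pos (by linarith) (by linarith)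
  · rw [Fin.succAbove_of_le_castSucc _ _ hj]
    have h1 : α i ≤ α j.castSucc := hα hj
    have := h j
    exact mul_pos_of_neg_of_neg (by linarith) (by linarith)

open Polynomial in
/-- If `g` has the same weak signs as an interlacer `q` of `p` at the zeros of `p`, then the
leading coefficients have the same weak sign too, strictly so unless `g = 0`. -/
theorem coeff_mul_leadingCoeff_of_interlaces {p q g : ℝ[X]} {m : ℕ} (hpm : p.natDegree = m + 1)
    (hqp : UnivInterlaces q p) (hpq : IsCoprime p q)
    (hg : g.natDegree ≤ m) (hsign : ∀ x, p.IsRoot x → 0 ≤ g.eval x * q.eval x) :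
    0 ≤ g.coeff m * q.coeff m ∧ (g.coeff m = 0 → g = 0) := by
  obtain ⟨-, -, m', hpm', hqm, α, β, hα, hβ, hpα, hqβ, hαβ⟩ := hqp
  obtain rfl : m' = m := by omega
  have hp0 : p ≠ 0 := fun h => by simp [h] at hpm
  have hq0 : q ≠ 0 := fun h => by
    have := hpq
    rw [h, isCoprime_zero_right] at this
    have := natDegree_eq_zero_of_isUnit this
    omega
  have hαroot : ∀ i, p.IsRoot (α i) := fun i => by
    rw [← mem_roots hp0, hpα]
    exact Multiset.mem_map_of_mem _ (Finset.mem_univ i)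
  have hβroot : ∀ i, q.IsRoot (β i) := fun i => by
    rw [← mem_roots hq0, hqβ]
    simp
  have hne : ∀ i j, α i ≠ β j := fun i j h => by
    have h1 : p.IsRoot (β j) := h ▸ hαroot i
    obtain ⟨u, v, huv⟩ := hpq
    have := congrArg (Polynomial.eval (β j)) huv
    rw [Polynomial.eval_add, Polynomial.eval_mul, Polynomial.eval_mul, h1.eq_zero, (hβroot j).eq_zero] at this
    simp at this
  have hinter : ∀ i : Fin m', α i.castSucc < β i ∧ β i < α i.succ := fun i =>
    ⟨(hαβ i).1.lt_of_ne (hne _ _), (hαβ i).2.lt_of_ne (hne _ _).symm⟩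
  have hαinj : Function.Injective α :=
    (Fin.strictMono_iff_lt_succ.2 fun i => (hinter i).1.trans (hinter i).2).injective
  set b := q.leadingCoeff with hb
  have hb' : q.coeff m' = b := by rw [hb, leadingCoeff, hqm]
  have hb0 : b ≠ 0 := leadingCoeff_ne_zero.2 hq0
  have hqprod : ∀ x, q.eval x = b * ∏ j, (x - β j) := fun x => by
    have hcard : q.roots.card = q.natDegree := by rw [hqβ, hqm]; simp
    conv_lhs => rw [← C_leadingCoeff_mul_prod_multiset_X_sub_C hcard]
    rw [Polynomial.eval_mul, Polynomial.eval_C, hqβ, Multiset.map_map]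
    congr 1
    change Polynomial.eval x (∏ j, (Polynomial.X - Polynomial.C (β j))) = _
    rw [Polynomial.eval_prod]
    simp
  have hgdeg : g.degree < (Finset.univ : Finset (Fin (m' + 1))).card := by
    rw [Finset.card_univ, Fintype.card_fin]
    exact lt_of_le_of_lt (degree_le_of_natDegree_le hg) (by exact_mod_cast Nat.lt_succ_self m')
  -- Since `deg g ≤ m` and there are `m + 1` nodes, the coefficient of degree `m` is the sum of `g
  -- (α i) / ∏ (α i - α j)`.
  have hcoeff := Lagrange.coeff_eq_sum (s := Finset.univ) hαinj.injOn hgdeg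
  rw [Finset.card_univ, Fintype.card_fin, Nat.add_sub_cancel] at hcoeff
  have herase : ∀ i, ∏ j ∈ Finset.univ.erase i, (α i - α j) =
      ∏ j : Fin m', (α i - α (i.succAbove j)) := fun i => by
    rw [← Finset.sdiff_singleton_eq_erase, ← Finset.compl_eq_univ_sdiff,
      ← Fin.image_succAbove_univ, Finset.prod_image Fin.succAbove_right_injective.injOn]
  have hterm : ∀ i, 0 ≤ g.eval (α i) / (∏ j ∈ Finset.univ.erase i, (α i - α j)) * b := fun i => by
    have h1 := prod_sub_mul_prod_sub_pos hinter i
    have h2 := hsign _ (hαroot i)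
    rw [hqprod] at h2
    rw [herase]
    set D := ∏ j : Fin m', (α i - α (i.succAbove j))
    set Q := ∏ j : Fin m', (α i - β j)
    have hD : D ≠ 0 := left_ne_zero_of_mul h1.ne'
    have h3 : g.eval (α i) / D * b = (g.eval (α i) * (b * Q)) / (D * Q) := by
      have hQ : Q ≠ 0 := right_ne_zero_of_mul h1.ne'
      field_simp
    rw [h3]
    exact div_nonneg h2 h1.le
  rw [hb', hcoeff, Finset.sum_mul]
  refine ⟨Finset.sum_nonneg fun i _ => hterm i, fun h0 => ?_⟩
  have hzero : ∀ i, g.eval (α i) = 0 := fun i => by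
    have h1 := (Finset.sum_eq_zero_iff_of_nonneg fun i _ => hterm i).1
      (by rw [← Finset.sum_mul, h0, zero_mul]) i (Finset.mem_univ i)
    have h2 := left_ne_zero_of_mul (prod_sub_mul_prod_sub_pos hinter i).ne'
    rw [← herase] at h2
    exact (div_eq_zero_iff.1 ((mul_eq_zero.1 h1).resolve_right hb0)).resolve_right h2
  exact eq_zero_of_natDegree_lt_card_of_eval_eq_zero g hαinj hzero
    (by rw [Fintype.card_fin]; omega)

/-! ### Restriction to lines and generic coprimality. -/

/-- `f (t e + a)` with `e`, `a` in an arbitrary algebra. -/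
theorem natDegree_le_and_coeff_aeval_line {σ R S : Type*} [CommRing R] [CommRing S] [Algebra R S]
    {f : MvPolynomial σ R} {k : ℕ} (hf : f.IsHomogeneous k) (e a : σ → S) :
    (aeval (fun i => Polynomial.C (e i) * Polynomial.X + Polynomial.C (a i)) f).natDegree ≤ k ∧
    (aeval (fun i => Polynomial.C (e i) * Polynomial.X + Polynomial.C (a i)) f).coeff k =
      aeval e f := by
  have hlin : ∀ i, (Polynomial.C (e i) * Polynomial.X + Polynomial.C (a i)).natDegree ≤ 1 :=
    fun i => Polynomial.natDegree_linear_le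
  have hprod : ∀ (T : Finset σ) (s : σ →₀ ℕ),
      (∏ i ∈ T, (Polynomial.C (e i) * Polynomial.X + Polynomial.C (a i)) ^ s i).natDegree
        ≤ ∑ i ∈ T, s i ∧
      (∏ i ∈ T, (Polynomial.C (e i) * Polynomial.X + Polynomial.C (a i)) ^ s i).coeff
        (∑ i ∈ T, s i) = ∏ i ∈ T, e i ^ s i := by
    classical
    intro T s
    induction T using Finset.induction with
    | empty => simp
    | insert j T hj ih =>
      rw [Finset.prod_insert hj, Finset.sum_insert hj, Finset.prod_insert hj]
      have h1 : ((Polynomial.C (e j) * Polynomial.X + Polynomial.C (a j)) ^ s j).natDegree ≤ s j := by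
        simpa using Polynomial.natDegree_pow_le_of_le (s j) (hlin j)
      refine ⟨Polynomial.natDegree_mul_le_of_le h1 ih.1, ?_⟩
      rw [Polynomial.coeff_mul_add_eq_of_natDegree_le h1 ih.1, ih.2]
      have := Polynomial.coeff_pow_of_natDegree_le (m := s j) (hlin j)
      simp only [mul_one] at this
      rw [this]
      simp
  have hdeg : ∀ s ∈ f.support, ∑ i ∈ s.support, s i = k := fun s hs =>
    (hf.degree_eq_sum_deg_support hs).symm
  simp only [aeval_def, eval₂_eq]
  constructor
  · refine Polynomial.natDegree_sum_le_of_forall_le _ _ fun s hs => ?_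
    rw [Polynomial.algebraMap_apply]
    refine (Polynomial.natDegree_C_mul_le _ _).trans ?_
    rw [← hdeg s hs]
    exact (hprod _ _).1
  · rw [Polynomial.finsetSum_coeff]
    refine Finset.sum_congr rfl fun s hs => ?_
    rw [Polynomial.algebraMap_apply, Polynomial.coeff_C_mul]
    congr 1
    rw [← hdeg s hs]
    exact (hprod _ _).2

theorem natDegree_lineRestrict_le {n k : ℕ} {f : MvPolynomial (Fin n) ℝ} (hf : f.IsHomogeneous k)
    (e a : Fin n → ℝ) : (lineRestrict f e a).natDegree ≤ k :=
  (natDegree_le_and_coeff_aeval_line hf e a).1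

theorem coeff_lineRestrict {n k : ℕ} {f : MvPolynomial (Fin n) ℝ} (hf : f.IsHomogeneous k)
    (e a : Fin n → ℝ) : (lineRestrict f e a).coeff k = eval e f := by
  rw [← coe_aeval_eq_eval]
  exact (natDegree_le_and_coeff_aeval_line hf e a).2

theorem eval_lineRestrict {n : ℕ} (f : MvPolynomial (Fin n) ℝ) (e a : Fin n → ℝ) (t : ℝ) :
    (lineRestrict f e a).eval t = eval (fun i => e i * t + a i) f := by
  rw [lineRestrict, ← Polynomial.coe_evalRingHom, ← coe_aeval_eq_eval]
  change (Polynomial.aeval t) _ = _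
  rw [← AlgHom.comp_apply, comp_aeval]
  simp

/-- `f (t e + x)` as a polynomial in `t` over the ring of polynomials in `x`. -/
noncomputable def genericLine {n : ℕ} (e : Fin n → ℝ) :
    MvPolynomial (Fin n) ℝ →ₐ[ℝ] Polynomial (MvPolynomial (Fin n) ℝ) :=
  aeval fun i => Polynomial.C (C (e i)) * Polynomial.X + Polynomial.C (X i)

theorem genericLine_X {n : ℕ} (e : Fin n → ℝ) (i : Fin n) :
    genericLine e (X i) = Polynomial.C (C (e i)) * Polynomial.X + Polynomial.C (X i) := by
  simp [genericLine]

theorem map_genericLine {n : ℕ} (e a : Fin n → ℝ) (f : MvPolynomial (Fin n) ℝ) :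
    (genericLine e f).map (eval a) = lineRestrict f e a := by
  have : (Polynomial.mapAlgHom (aeval a)).comp (genericLine e) = 
      aeval (fun i => Polynomial.C (e i) * Polynomial.X + Polynomial.C (a i)) := by
    ext1 i
    simp [genericLine_X]
  exact DFunLike.congr_fun this f

theorem natDegree_genericLine_le {n k : ℕ} {f : MvPolynomial (Fin n) ℝ} (hf : f.IsHomogeneous k)
    (e : Fin n → ℝ) : (genericLine e f).natDegree ≤ k :=
  (natDegree_le_and_coeff_aeval_line hf (fun i => C (e i)) X).1

theorem coeff_genericLine {n k : ℕ} {f : MvPolynomial (Fin n) ℝ} (hf : f.IsHomogeneous k)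
    (e : Fin n → ℝ) : (genericLine e f).coeff k = C (eval e f) := by
  refine (natDegree_le_and_coeff_aeval_line hf (fun i => C (e i)) X).2.trans ?_
  have : (aeval fun i => (C (e i) : MvPolynomial (Fin n) ℝ)) =
      (Algebra.ofId ℝ (MvPolynomial (Fin n) ℝ)).comp (aeval e) := by
    ext1 i
    simp [Algebra.ofId_apply, algebraMap_eq]
  rw [this, ← coe_aeval_eq_eval]
  rfl

/-- The substitution `x ↦ x + t e`, as an endomorphism of `ℝ[x][t]`. -/
noncomputable def lineTranslate {n : ℕ} (e : Fin n → ℝ) :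
    Polynomial (MvPolynomial (Fin n) ℝ) →+* Polynomial (MvPolynomial (Fin n) ℝ) :=
  Polynomial.eval₂RingHom (genericLine e : _ →+* _) Polynomial.X

theorem lineTranslate_C {n : ℕ} (e : Fin n → ℝ) (f : MvPolynomial (Fin n) ℝ) :
    lineTranslate e (Polynomial.C f) = genericLine e f := by
  simp [lineTranslate]

theorem lineTranslate_comp_neg {n : ℕ} (e : Fin n → ℝ) :
    (lineTranslate e).comp (lineTranslate (-e)) = RingHom.id _ := by
  ext i : 2
  · ext r : 1
    simp [lineTranslate, genericLine, algebraMap_eq]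
  · simp only [lineTranslate, RingHom.comp_apply, Polynomial.coe_eval₂RingHom,
      Polynomial.eval₂_C, RingHom.coe_coe, genericLine_X, Polynomial.eval₂_add,
      Polynomial.eval₂_mul, Polynomial.eval₂_X, RingHom.id_apply, Pi.neg_apply]
    rw [← algebraMap_eq, AlgHom.commutes, Polynomial.algebraMap_apply, algebraMap_eq, C_neg,
      Polynomial.C_neg]
    ring
  · simp [lineTranslate]

/-- Translation by `t e` is an automorphism of `ℝ[x][t]`, with inverse translation by `-t e`, and it
carries the constant `f` to its generic restriction. -/
theorem prime_genericLine {n : ℕ} (e : Fin n → ℝ) {f : MvPolynomial (Fin n) ℝ} (hf : Prime f) :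
    Prime (genericLine e f) := by
  have h := lineTranslate_comp_neg (-e)
  rw [neg_neg] at h
  have := (MulEquiv.prime_iff (RingEquiv.ofRingHom _ _ (lineTranslate_comp_neg e) h)).2
    (Polynomial.prime_C_iff.2 hf)
  rwa [RingEquiv.ofRingHom_apply, lineTranslate_C] at this

-- By Gauss's lemma `P` stays irreducible over the fraction field, where Bézout applies; clearing
-- denominators leaves the constant `r`.
open Polynomial in
theorem exists_bezout_of_monic_of_irreducible {S : Type*} [CommRing S] [IsDomain S]
    [IsIntegrallyClosed S] {P H : S[X]} (hP : P.Monic) (hirr : Irreducible P) (hPH : ¬ P ∣ H) :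
    ∃ (u v : S[X]) (r : S), r ≠ 0 ∧ u * P + v * H = Polynomial.C r := by
  let K := FractionRing S
  have hinj : Function.Injective (algebraMap S K) := IsFractionRing.injective S K
  have h1 := (hP.irreducible_iff_irreducible_map_fraction_map (K := K)).1 hirr
  have h2 : ¬ P.map (algebraMap S K) ∣ H.map (algebraMap S K) := fun h =>
    hPH ((Polynomial.map_dvd_map _ hinj hP).1 h)
  obtain ⟨u, v, huv⟩ := (h1.coprime_iff_not_dvd).2 h2
  obtain ⟨b, hb, hbu⟩ := IsLocalization.integerNormalization_spec (nonZeroDivisors S) u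
  obtain ⟨c, hc, hcv⟩ := IsLocalization.integerNormalization_spec (nonZeroDivisors S) v
  refine ⟨Polynomial.C c * IsLocalization.integerNormalization (nonZeroDivisors S) u,
    Polynomial.C b * IsLocalization.integerNormalization (nonZeroDivisors S) v, c * b,
    mul_ne_zero (nonZeroDivisors.ne_zero hc) (nonZeroDivisors.ne_zero hb), ?_⟩
  apply Polynomial.map_injective _ hinj
  simp only [Polynomial.map_add, Polynomial.map_mul, Polynomial.map_C, hbu, hcv, map_mul,
    Algebra.smul_def, Polynomial.algebraMap_apply]
  linear_combination (Polynomial.C (algebraMap S K c) * Polynomial.C (algebraMap S K b)) * huv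

/-- For generic `a`, the restrictions to the line through `a` in direction `e` are coprime. -/
theorem exists_isCoprime_lineRestrict {n k m : ℕ} {f q : MvPolynomial (Fin n) ℝ}
    (e : Fin n → ℝ) (hf : Prime f) (hfk : f.IsHomogeneous k) (hfe : eval e f ≠ 0)
    (hq : q.IsHomogeneous m) (hmk : m < k) (hqe : eval e q ≠ 0) :
    ∃ r : MvPolynomial (Fin n) ℝ, r ≠ 0 ∧
      ∀ a, eval a r ≠ 0 → IsCoprime (lineRestrict f e a) (lineRestrict q e a) := by
  set s := (eval e f)⁻¹ with hs
  have hs0 : s ≠ 0 := inv_ne_zero hfe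
  have hfs : Prime (C s * f) :=
    ((associated_unit_mul_left f (C s) ((isUnit_iff_ne_zero.2 hs0).map C)).prime_iff).2 hf
  have hfk' : (C s * f).IsHomogeneous k := hfk.C_mul s
  have hev : eval e (C s * f) = 1 := by
    rw [map_mul, eval_C, hs, inv_mul_cancel₀ hfe]
  have hmonic : (genericLine e (C s * f)).Monic :=
    Polynomial.monic_of_natDegree_le_of_coeff_eq_one k (natDegree_genericLine_le hfk' e)
      (by rw [coeff_genericLine hfk', hev, C_1])
  have hndvd : ¬ genericLine e (C s * f) ∣ genericLine e q := by
    intro h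
    have hq0 : genericLine e q ≠ 0 := fun h0 => by
      have := coeff_genericLine hq e
      rw [h0, Polynomial.coeff_zero] at this
      exact hqe (C_eq_zero.1 this.symm)
    have h1 := Polynomial.natDegree_le_of_dvd h hq0
    have h2 : k ≤ (genericLine e (C s * f)).natDegree :=
      Polynomial.le_natDegree_of_ne_zero (by rw [coeff_genericLine hfk', hev]; simp)
    have h3 := natDegree_genericLine_le hq e
    omega
  obtain ⟨u, v, r, hr, huv⟩ := exists_bezout_of_monic_of_irreducible hmonic
    (prime_genericLine e hfs).irreducible hndvd
  refine ⟨r, hr, fun a ha => ?_⟩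
  have h1 := congrArg (Polynomial.map (eval a)) huv
  rw [Polynomial.map_add, Polynomial.map_mul, Polynomial.map_mul, map_genericLine,
    map_genericLine, Polynomial.map_C] at h1
  have h2 : lineRestrict (C s * f) e a = Polynomial.C s * lineRestrict f e a := by
    simp [lineRestrict]
  have hca : Polynomial.C (eval a r)⁻¹ * Polynomial.C (eval a r) = 1 := by
    rw [← Polynomial.C_mul, inv_mul_cancel₀ ha, Polynomial.C_1]
  rw [h2] at h1
  refine ⟨Polynomial.C (eval a r)⁻¹ * u.map (eval a) * Polynomial.C s,
    Polynomial.C (eval a r)⁻¹ * v.map (eval a), ?_⟩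
  linear_combination Polynomial.C (eval a r)⁻¹ * h1 + hca

theorem interlacer_eval_ne_zero {n m : ℕ} {f q : MvPolynomial (Fin n) ℝ} {e : Fin n → ℝ}
    (hfm : f.IsHomogeneous (m + 1)) (hf0 : f ≠ 0) (hint : InterlacesWrt q f e) :
    eval e q ≠ 0 := by
  obtain ⟨⟨-, hfe, -⟩, ⟨m', hfm', hqm'⟩, hline⟩ := hint
  obtain rfl : m' = m := by
    have := hfm'.inj_right hfm hf0
    omega
  obtain ⟨-, hreal, k, hk, hqk, -⟩ := hline 0
  have hdeg : (lineRestrict f e 0).natDegree = m' + 1 :=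
    le_antisymm (natDegree_lineRestrict_le hfm e 0)
      (Polynomial.le_natDegree_of_ne_zero (by rwa [coeff_lineRestrict hfm]))
  obtain rfl : k = m' := by omega
  -- The zero polynomial is not real-rooted, since `i` is one of its roots.
  have hq0 : lineRestrict q e 0 ≠ 0 := fun h => by
    have := hreal Complex.I (by rw [h, map_zero])
    simp at this
  have h := Polynomial.leadingCoeff_ne_zero.2 hq0
  rwa [Polynomial.leadingCoeff, hqk, coeff_lineRestrict hqm'] at h

/-- A form of degree `deg f - 1` with the same weak signs as an interlacer on the real zeros of
`f` does not vanish at `e` unless it is zero. -/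
theorem eval_mul_eval_of_interlaces {n m : ℕ} {f q g : MvPolynomial (Fin n) ℝ} {e : Fin n → ℝ}
    (hf : Prime f) (hfm : f.IsHomogeneous (m + 1)) (hqm : q.IsHomogeneous m)
    (hgm : g.IsHomogeneous m) (hqe : eval e q ≠ 0) (hint : InterlacesWrt q f e)
    (hsign : ∀ x, eval x f = 0 → 0 ≤ eval x g * eval x q) :
    0 ≤ eval e g * eval e q ∧ (eval e g = 0 → g = 0) := by
  have hfe : eval e f ≠ 0 := hint.1.2.1
  obtain ⟨r, hr, hcop⟩ := exists_isCoprime_lineRestrict e hf hfm hfe hqm (Nat.lt_succ_self m) hqe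
  have key : ∀ a, eval a r ≠ 0 → 0 ≤ eval e g * eval e q ∧
      (eval e g = 0 → lineRestrict g e a = 0) := fun a ha => by
    have hdeg : (lineRestrict f e a).natDegree = m + 1 :=
      le_antisymm (natDegree_lineRestrict_le hfm e a)
        (Polynomial.le_natDegree_of_ne_zero (by rwa [coeff_lineRestrict hfm]))
    have := coeff_mul_leadingCoeff_of_interlaces hdeg (hint.2.2 a) (hcop a ha)
      (natDegree_lineRestrict_le hgm e a) fun t ht => by
        rw [Polynomial.IsRoot, eval_lineRestrict] at ht
        rw [eval_lineRestrict, eval_lineRestrict]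
        exact hsign _ ht
    rwa [coeff_lineRestrict hgm, coeff_lineRestrict hqm] at this
  constructor
  · obtain ⟨a, ha⟩ : ∃ a, eval a r ≠ 0 := by
      by_contra! h
      exact hr (MvPolynomial.funext fun a => by rw [h a, map_zero])
    exact (key a ha).1
  · intro h0
    -- Only lines with `r(a) ≠ 0` are controlled; multiplying by `r` covers the remaining points.
    have : g * r = 0 := MvPolynomial.funext fun a => by
      rw [map_mul, map_zero]
      by_cases ha : eval a r = 0
      · rw [ha, mul_zero]
      · have h1 := congrArg (Polynomial.eval 0) ((key a ha).2 h0)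
        rw [eval_lineRestrict, Polynomial.eval_zero] at h1
        simp only [mul_zero, zero_add] at h1
        rw [h1, zero_mul]
    exact (mul_eq_zero.1 this).resolve_right hr

/-! ### The quadratic form of `A` and definiteness. -/

theorem dvd_mul_quadraticForm_sub_sq {R ι : Type*} [CommRing R] [Fintype ι] {f : R}
    {A : Matrix ι ι R} (hsymm : A.IsSymm)
    (hrank : ∀ i j k l, f ∣ A i k * A j l - A i l * A j k) (w : ι → R) (i : ι) :
    f ∣ A i i * (w ⬝ᵥ A.mulVec w) - (A.mulVec w i) ^ 2 := by
  have : A i i * (w ⬝ᵥ A.mulVec w) - (A.mulVec w i) ^ 2 =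
      ∑ j, ∑ l, w j * w l * (A i i * A j l - A i l * A j i) := by
    simp only [Matrix.mulVec, dotProduct, sq, Finset.mul_sum, Finset.sum_mul]
    rw [← Finset.sum_sub_distrib]
    refine Finset.sum_congr rfl fun j _ => ?_
    rw [← Finset.sum_sub_distrib]
    refine Finset.sum_congr rfl fun l _ => ?_
    rw [hsymm.apply j i]
    ring
  rw [this]
  exact Finset.dvd_sum fun j _ => Finset.dvd_sum fun l _ => (hrank i j i l).mul_left _

theorem quadraticForm_pos {n m : ℕ} {f : MvPolynomial (Fin n) ℝ} {e : Fin n → ℝ}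
    (hf : Prime f) (hfm : f.IsHomogeneous (m + 1))
    {A : Matrix (Fin (m + 1)) (Fin (m + 1)) (MvPolynomial (Fin n) ℝ)} (hsymm : A.IsSymm)
    (hdeg : ∀ i j, (A i j).IsHomogeneous m) (hrank : RankLEOneMod A f)
    (hint : InterlacesWrt (A 0 0) f e) (hfull : FullRank A) {v : Fin (m + 1) → ℝ} (hv : v ≠ 0) :
    0 < v ⬝ᵥ (A.map (eval e)).mulVec v * eval e (A 0 0) := by
  set w : Fin (m + 1) → MvPolynomial (Fin n) ℝ := fun i => C (v i) with hw
  set g := w ⬝ᵥ A.mulVec w with hg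
  have hAw : ∀ i, (A.mulVec w i).IsHomogeneous m := fun i =>
    IsHomogeneous.sum _ _ _ fun j _ => by
      rw [mul_comm]
      exact (hdeg i j).C_mul _
  have hgm : g.IsHomogeneous m := IsHomogeneous.sum _ _ _ fun j _ => (hAw j).C_mul _
  have hdvd := dvd_mul_quadraticForm_sub_sq hsymm hrank w
  have hge : eval e g = v ⬝ᵥ (A.map (eval e)).mulVec v := by
    simp [hg, hw, Matrix.mulVec, dotProduct, map_sum, map_mul]
  have hqe := interlacer_eval_ne_zero hfm hf.ne_zero hint
  have hsign : ∀ x, eval x f = 0 → 0 ≤ eval x g * eval x (A 0 0) := fun x hx => by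
    obtain ⟨h, hh⟩ := hdvd 0
    have := congrArg (eval x) hh
    rw [map_mul, hx, zero_mul, map_sub, map_mul, map_pow] at this
    nlinarith [sq_nonneg (eval x (A.mulVec w 0))]
  obtain ⟨hnonneg, hzero⟩ := eval_mul_eval_of_interlaces hf hfm (hdeg 0 0) hgm hqe hint hsign
  rw [← hge]
  refine hnonneg.lt_of_ne fun h => hv (hfull v (_root_.funext fun i => ?_))
  have hg0 := hzero ((mul_eq_zero.1 h.symm).resolve_right hqe)
  have h1 := hdvd i
  rw [← hg, hg0, mul_zero, zero_sub, dvd_neg] at h1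
  -- With `g = 0`, `f` divides the square of the `i`-th entry of `A v`, hence the entry, whose
  -- degree `m` is too small.
  exact eq_zero_of_dvd_of_isHomogeneous hfm hf.ne_zero (hAw i) (Nat.lt_succ_self m)
    (hf.dvd_of_dvd_pow h1)

theorem isDefiniteMatrix_smul {d : ℕ} {B : Matrix (Fin d) (Fin d) ℝ} (hB : IsDefiniteMatrix B)
    {c : ℝ} (hc : c ≠ 0) : IsDefiniteMatrix (c • B) := by
  rcases hc.lt_or_gt with h | h <;> rcases hB with hB | hB
  · exact Or.inr (by simpa using hB.smul (neg_pos.2 h))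
  · exact Or.inl (by simpa using hB.smul (neg_pos.2 h))
  · exact Or.inl (hB.smul h)
  · exact Or.inr (by simpa using hB.smul h)

theorem det_ne_zero_of_isDefiniteMatrix {d : ℕ} {B : Matrix (Fin d) (Fin d) ℝ}
    (hB : IsDefiniteMatrix B) : B.det ≠ 0 := by
  rcases hB with hB | hB
  · exact hB.det_pos.ne'
  · have := hB.det_pos.ne'
    rw [Matrix.det_neg] at this
    exact right_ne_zero_of_mul this

theorem isDefiniteMatrix_inv {d : ℕ} {B : Matrix (Fin d) (Fin d) ℝ} (hB : IsDefiniteMatrix B) :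
    IsDefiniteMatrix B⁻¹ := by
  rcases hB with hB | hB
  · exact Or.inl hB.inv
  · refine Or.inr ?_
    have h := hB.inv
    have : (-B)⁻¹ = -B⁻¹ := by
      apply Matrix.inv_eq_left_inv
      rw [neg_mul_neg, Matrix.nonsing_inv_mul _
        (isUnit_iff_ne_zero.2 (det_ne_zero_of_isDefiniteMatrix (.inr hB)))]
    rwa [this] at h

theorem isDefiniteMatrix_of_quadraticForm {d : ℕ} {B : Matrix (Fin d) (Fin d) ℝ}
    (hsymm : B.IsSymm) {c : ℝ} (h : ∀ v ≠ 0, 0 < v ⬝ᵥ B.mulVec v * c) : IsDefiniteMatrix B := by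
  -- For `c = 0` the hypothesis reads `0 < 0` for every nonzero `v`, so this case is vacuous.
  rcases eq_or_ne c 0 with rfl | hc
  · left
    refine .of_dotProduct_mulVec_pos (by simpa [Matrix.IsHermitian] using hsymm.eq) fun v hv => ?_
    simpa using h v hv
  · have hpos : IsDefiniteMatrix (c • B) := by
      refine Or.inl (.of_dotProduct_mulVec_pos ?_ fun v hv => ?_)
      · rw [Matrix.IsHermitian, Matrix.conjTranspose_eq_transpose_of_trivial, Matrix.transpose_smul,
          hsymm.eq]
      · have := h v hv
        simp only [Matrix.smul_mulVec, dotProduct_smul, star_trivial, smul_eq_mul]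
        linarith
    have := isDefiniteMatrix_smul hpos (inv_ne_zero hc)
    rwa [smul_smul, inv_mul_cancel₀ hc, one_smul] at this

theorem theorem4p7 {n d : ℕ} [NeZero d]
    (f : MvPolynomial (Fin n) ℝ) (e : Fin n → ℝ)
    (hfd : f.IsHomogeneous d) (hirr : Irreducible f) (hhyp : HyperbolicWrt f e)
    (A : Matrix (Fin d) (Fin d) (MvPolynomial (Fin n) ℝ)) (hsymm : A.IsSymm)
    (hdeg : ∀ i j, (A i j).IsHomogeneous (d - 1))
    (hrank : RankLEOneMod A f) :
    (∀ i j, f ^ (d - 2) ∣ A.adjugate i j) ∧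
    ∃ M : Matrix (Fin d) (Fin d) (MvPolynomial (Fin n) ℝ),
      f ^ (d - 1) • M = f • A.adjugate ∧
      (∀ i j, (M i j).IsHomogeneous 1) ∧
      ∃ γ : ℝ, M.det = MvPolynomial.C γ * f ∧
        (InterlacesWrt (A 0 0) f e → FullRank A →
          γ ≠ 0 ∧ IsDefiniteMatrix (M.map (MvPolynomial.eval e))) := by
  obtain ⟨m, rfl⟩ := Nat.exists_eq_succ_of_ne_zero (NeZero.ne d)
  have hf : Prime f := hirr.prime
  obtain ⟨hadj, M, hMA, hM1, γ, hγ⟩ := exists_divided_adjugate hfd hf hdeg hrank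
  refine ⟨hadj, M, hMA, hM1, γ, hγ, fun hint hfull => ?_⟩
  have hfe : eval e f ≠ 0 := hhyp.2.1
  set E := A.map (eval e) with hE
  have hEdef : IsDefiniteMatrix E := by
    refine isDefiniteMatrix_of_quadraticForm (c := eval e (A 0 0)) ?_ fun v hv =>
      quadraticForm_pos hf hfd hsymm hdeg hrank hint hfull hv
    rw [Matrix.IsSymm, hE, ← Matrix.transpose_map, hsymm.eq]
  have hdet : E.det ≠ 0 := det_ne_zero_of_isDefiniteMatrix hEdef
  have hEadj : A.adjugate.map (eval e) = E.det • E⁻¹ := by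
    rw [Matrix.inv_def, smul_smul, Ring.inverse_eq_inv', mul_inv_cancel₀ hdet, one_smul]
    exact RingHom.map_adjugate (eval e) A
  have hMe : M.map (eval e) = ((eval e f ^ m)⁻¹ * eval e f * E.det) • E⁻¹ := by
    have h1 : eval e f ^ m • M.map (eval e) = eval e f • A.adjugate.map (eval e) := by
      ext i j
      simpa using congrArg (fun N => eval e (N i j)) hMA
    rw [← smul_smul, ← hEadj, ← smul_smul, ← h1, smul_smul,
      inv_mul_cancel₀ (pow_ne_zero _ hfe), one_smul]
  have hdef : IsDefiniteMatrix (M.map (eval e)) := by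
    rw [hMe]
    exact isDefiniteMatrix_smul (isDefiniteMatrix_inv hEdef)
      (mul_ne_zero (mul_ne_zero (inv_ne_zero (pow_ne_zero _ hfe)) hfe) hdet)
  refine ⟨fun h0 => det_ne_zero_of_isDefiniteMatrix hdef ?_, hdef⟩
  have h1 : (M.map (eval e)).det = eval e M.det := (RingHom.map_det (eval e) M).symm
  rw [h1, hγ, h0, map_mul, eval_C, zero_mul]
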